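/- Let $K$ be a field of characteristic $p>0$, let $G$ be a finite group whose order is divisible by $p$, and let $n\ge 0$. Let $G$ act on the polynomial ring $R=K[x_1,\dots,x_n]$ by linear transformations of the variables, that is, through a homomorphism $\rho=(\rho_{ij}):G\to \mathrm{GL}_n(K)$ with $\sigma(x_i)=\sum_{j=1}^n \rho_{ji}(\sigma)\,x_j$ for $\sigma\in G$ (the action need not be faithful). Correspondingly, $G$ acts linearly on $V=K^n$ in such a way that $(\sigma f)(v)=f(\sigma^{-1}v)$ for all $f\in R$, $v\in V$, $\sigma\in G$. Let $R^G$ be the ring of invariants. A homogeneous system of parameters (hsop) consists of $n$ homogeneous invariants $f_1,\dots,f_n\in R^G$ such that $R^G$ is finitely generated as a module over the subalgebra $K[f_1,\dots,f_n]$. The ring $R^G$ is called Cohen–Macaulay if it is free as a module over the subalgebra generated by some hsop. An element $\sigma\in G$ is called a $p'$-element if its order is not divisible by $p$, and a bireflection if its fixed space $V^\sigma=\{v\in V:\sigma v=v\}$ has codimension at most $2$ in $V$. **Theorem.** If $R^G$ is Cohen–Macaulay, then $G$ is generated by its $p'$-elements and its bireflections. -/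

import Mathlib

/-- The action of `G` on the polynomial ring `K[x₁, …, xₙ]` by the linear transformations
`σ(xᵢ) = ∑ⱼ ρ(σ)ⱼᵢ xⱼ` of the variables, where `ρ : G → GLₙ(K)` is a homomorphism. -/
noncomputable def polyAction {K G : Type*} [Field K] [Group G] {n : ℕ}
    (ρ : G →* Matrix.GeneralLinearGroup (Fin n) K) :
    G →* (MvPolynomial (Fin n) K →ₐ[K] MvPolynomial (Fin n) K) where
  toFun σ := MvPolynomial.aeval fun i => ∑ j, ρ σ j i • MvPolynomial.X j
  map_one' := by
    ext i : 1
    simp [Matrix.one_apply, ite_smul]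
  map_mul' σ τ := by
    ext i : 1
    simp only [MvPolynomial.aeval_X, AlgHom.mul_apply, map_sum, map_smul, map_mul,
      Matrix.GeneralLinearGroup.coe_mul, Matrix.mul_apply, Finset.sum_smul, Finset.smul_sum,
      smul_smul]
    rw [Finset.sum_comm]
    simp only [mul_comm]

/-- The invariant ring `R^G`, where `R = K[x₁, …, xₙ]`. -/
noncomputable def invariantRing {K G : Type*} [Field K] [Group G] {n : ℕ}
    (ρ : G →* Matrix.GeneralLinearGroup (Fin n) K) :
    Subalgebra K (MvPolynomial (Fin n) K) where
  carrier := {f | ∀ σ : G, polyAction ρ σ f = f}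
  mul_mem' hf hg σ := by rw [map_mul, hf σ, hg σ]
  add_mem' hf hg σ := by rw [map_add, hf σ, hg σ]
  algebraMap_mem' c σ := (polyAction ρ σ).commutes c

/-- `f₁, …, fₙ` (with `n` the number of variables) is a homogeneous system of parameters
(a system of primary invariants): the `fᵢ` are homogeneous invariants, and `R^G` is finitely
generated as a module over the subalgebra `K[f₁, …, fₙ]`. -/
def IsHsop {K G : Type*} [Field K] [Group G] {n : ℕ}
    (ρ : G →* Matrix.GeneralLinearGroup (Fin n) K) (f : Fin n → invariantRing ρ) : Prop :=
  (∀ i, ∃ d : ℕ, (f i : MvPolynomial (Fin n) K).IsHomogeneous d) ∧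
    Module.Finite (Algebra.adjoin K (Set.range f)) (invariantRing ρ)

/-- `R^G` is Cohen–Macaulay: it is free as a module over the subalgebra generated by some
homogeneous system of parameters. -/
def InvariantRingIsCohenMacaulay {K G : Type*} [Field K] [Group G] {n : ℕ}
    (ρ : G →* Matrix.GeneralLinearGroup (Fin n) K) : Prop :=
  ∃ f : Fin n → invariantRing ρ,
    IsHsop ρ f ∧ Module.Free (Algebra.adjoin K (Set.range f)) (invariantRing ρ)

/-- The linear action of `σ ∈ G` on the space of points `V = Kⁿ`, the one for which
`(σ f)(v) = f(σ⁻¹ v)` for all polynomials `f` (see `eval_polyAction`). -/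
noncomputable def pointAction {K G : Type*} [Field K] [Group G] {n : ℕ}
    (ρ : G →* Matrix.GeneralLinearGroup (Fin n) K) (σ : G) : (Fin n → K) →ₗ[K] (Fin n → K) :=
  Matrix.mulVecLin (ρ σ⁻¹ : Matrix (Fin n) (Fin n) K).transpose

theorem eval_polyAction {K G : Type*} [Field K] [Group G] {n : ℕ}
    (ρ : G →* Matrix.GeneralLinearGroup (Fin n) K) (σ : G) (f : MvPolynomial (Fin n) K)
    (v : Fin n → K) :
    MvPolynomial.eval v (polyAction ρ σ f) = MvPolynomial.eval (pointAction ρ σ⁻¹ v) f := by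
  induction f using MvPolynomial.induction_on with
  | C a => rw [← MvPolynomial.algebraMap_eq, AlgHom.commutes]; simp
  | add p q hp hq => rw [map_add, map_add, hp, hq, map_add]
  | mul_X p i hp =>
    rw [map_mul, map_mul, hp, map_mul]
    congr 1
    simp [polyAction, pointAction, Matrix.vecMul, dotProduct, MvPolynomial.smul_eval, mul_comm]

/-- The subspace `V^σ` of all points of `V = Kⁿ` that are fixed by `σ`. -/
noncomputable def fixedSpace {K G : Type*} [Field K] [Group G] {n : ℕ}
    (ρ : G →* Matrix.GeneralLinearGroup (Fin n) K) (σ : G) : Submodule K (Fin n → K) :=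
  LinearMap.eqLocus (pointAction ρ σ) LinearMap.id

/-- `σ` is a bireflection: its fixed space has codimension at most `2`. -/
def IsBireflection {K G : Type*} [Field K] [Group G] {n : ℕ}
    (ρ : G →* Matrix.GeneralLinearGroup (Fin n) K) (σ : G) : Prop :=
  Module.finrank K ((Fin n → K) ⧸ fixedSpace ρ σ) ≤ 2

/-!
Suppose that the subgroup generated by the `p'`-elements and the bireflections is proper. It is
normal and its quotient is a nontrivial `p`-group, so it lies in the kernel `N` of a surjective
homomorphism `χ : G → ℤ/p`. Viewed as a cocycle with values in `K ⊆ R`, `χ` has nonzero class in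
`H¹(G, R)`, because `G` fixes constant terms. The proof derives a contradiction from the
annihilator `I ⊆ R^G` of this class (`cocycleAnnihilator`).

*The annihilator is large.* It contains the relative traces of `N`-invariants
(`mem_cocycleAnnihilator_of_trace`). Let a prime `𝔭` of `R^G` contain all of them and let `𝔮` lie
over `𝔭`. Independence of characters shows that two different powers of a generator of `G/N` agree
on `R^N` modulo `𝔮`; correcting by an element of `N` (`exists_forall_eq_comp_smul`) gives some
`σ ∉ N` that acts trivially on `R/𝔮`. Hence an invariant lies in the radical of `I` as soon as it
vanishes on `V^σ` for all `σ ∉ N` (`mem_radical_cocycleAnnihilator`). Each of these `V^σ` has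
codimension at least `3`, so any `n - 2` polynomials satisfy a nontrivial relation on it.

*Regular sequences.* Let `R^G` be free over `A₀ = K[f₁, …, fₙ]`, a polynomial ring. Any `n - 2`
elements of `A₀` are algebraically dependent modulo `I ∩ A₀`. Changing variables twice as in
Noether normalization yields elements of `I ∩ A₀` that are respectively free of two variables,
monic in the one and free of the other, and monic in the other; they form a regular sequence in
`A₀` (`exists_isRegularTriple_of_algebraic_mod`), hence in the free module `R^G`.

*The contradiction.* Let `f₁, f₂, f₃ ∈ I` be regular on `R^G` and write
`χ(σ) fᵢ = σ bᵢ - bᵢ`. The minors `uᵢⱼ = fᵢ bⱼ - fⱼ bᵢ` are invariant and satisfy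
`f₁ u₂₃ - f₂ u₁₃ + f₃ u₁₂ = 0`, so regularity writes `u₁₂` as a combination of `f₁` and `f₂` over
`R^G`. Since `f₁` and `f₂` are coprime in `R`, this makes `χ` itself a coboundary
(`one_mem_cocycleAnnihilator_of_isRegularTriple`).
-/

/-! ### Homomorphisms onto `ℤ/p` -/

theorem exists_surjective_hom_zmod_of_isPGroup {Q : Type*} [Group Q] [Finite Q] [Nontrivial Q]
    {p : ℕ} [hp : Fact p.Prime] (hQ : IsPGroup p Q) :
    ∃ χ : Q →* Multiplicative (ZMod p), Function.Surjective χ := by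
  obtain ⟨m, hm⟩ := IsPGroup.iff_card.1 hQ
  obtain ⟨k, rfl⟩ : ∃ k, m = k + 1 := Nat.exists_eq_succ_of_ne_zero <| by
    rintro rfl
    exact Finite.one_lt_card (α := Q).ne' (by simpa using hm)
  obtain ⟨M, hM⟩ := Sylow.exists_subgroup_card_pow_prime (G := Q) p (n := k)
    (hm ▸ pow_dvd_pow p k.le_succ)
  have hidx : M.index = p := by
    have h := M.card_mul_index
    rw [hM, hm, pow_succ] at h
    exact Nat.eq_of_mul_eq_mul_left (pow_pos hp.out.pos k) h
  have hnormal : M.Normal := Subgroup.normal_of_index_eq_minFac_card <| by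
    rw [hidx, hm, hp.out.pow_minFac k.succ_ne_zero]
  have e : Q ⧸ M ≃* Multiplicative (ZMod p) := mulEquivOfPrimeCardEq (p := p)
    (by rw [← hidx]; rfl) (by simp)
  exact ⟨e.toMonoidHom.comp (QuotientGroup.mk' M),
    e.surjective.comp (QuotientGroup.mk'_surjective M)⟩

theorem exists_surjective_hom_zmod_of_normal {G : Type*} [Group G] [Finite G] {p : ℕ}
    [hp : Fact p.Prime] (H : Subgroup G) [H.Normal] (hH : H ≠ ⊤)
    (hmem : ∀ σ : G, ¬ p ∣ orderOf σ → σ ∈ H) :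
    ∃ χ : G →* Multiplicative (ZMod p), Function.Surjective χ ∧ H ≤ χ.ker := by
  have hnt : Nontrivial (G ⧸ H) := QuotientGroup.nontrivial_iff.2 hH
  have hQ : IsPGroup p (G ⧸ H) := fun q ↦ by
    obtain ⟨σ, rfl⟩ := QuotientGroup.mk'_surjective H q
    obtain ⟨a, m, hm, ha⟩ :=
      Nat.exists_eq_pow_mul_and_not_dvd (orderOf_pos σ).ne' p hp.out.ne_one
    refine ⟨a, ?_⟩
    rw [← map_pow]
    refine (QuotientGroup.eq_one_iff _).2 (hmem _ ?_)
    rwa [orderOf_pow_of_dvd (pow_pos hp.out.pos a).ne' (ha ▸ dvd_mul_right _ _), ha,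
      Nat.mul_div_cancel_left _ (pow_pos hp.out.pos a)]
  obtain ⟨χ, hχ⟩ := exists_surjective_hom_zmod_of_isPGroup hQ
  refine ⟨χ.comp (QuotientGroup.mk' H), hχ.comp (QuotientGroup.mk'_surjective H), fun σ hσ ↦ ?_⟩
  simp [MonoidHom.mem_ker, (QuotientGroup.eq_one_iff σ).2 hσ]

/-! ### Regular sequences in polynomial rings -/

open MvPolynomial in
/-- Nagata's change of variables: after the substitution `Xᵢ ↦ Xᵢ + X₀ ^ (u ^ i)` with `u` large,
a given nonzero polynomial becomes monic in `X₀` up to a unit. -/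
theorem exists_algEquiv_isUnit_leadingCoeff {K : Type*} [Field K] {n : ℕ}
    {f : MvPolynomial (Fin (n + 1)) K} (hf : f ≠ 0) :
    ∃ e : MvPolynomial (Fin (n + 1)) K ≃ₐ[K] Polynomial (MvPolynomial (Fin n) K),
      IsUnit (e f).leadingCoeff := by
  set u := 2 + f.totalDegree with hu
  let T (c : K) : MvPolynomial (Fin (n + 1)) K →ₐ[K] MvPolynomial (Fin (n + 1)) K :=
    aeval fun i ↦ if i = 0 then X 0 else X i + c • X 0 ^ (u ^ (i : ℕ))
  have hT (c : K) : (T c).comp (T (-c)) = AlgHom.id _ _ := by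
    ext i : 1
    cases i using Fin.cases <;> simp [T]
  let e := (AlgEquiv.ofAlgHom (T 1) (T (-1)) (hT 1) (by simpa using hT (-1))).trans
    (finSuccEquiv K n)
  let w (v : Fin (n + 1) →₀ ℕ) : ℕ := ∑ i : Fin (n + 1), u ^ (i : ℕ) * v i
  have hX (i) : (e (X i)).Monic ∧ (e (X i)).natDegree = u ^ (i : ℕ) := by
    cases i using Fin.cases with
    | zero => simp [e, T, finSuccEquiv_X_zero, Polynomial.monic_X]
    | succ j =>
      have h : e (X j.succ) = Polynomial.X ^ (u ^ (j.succ : ℕ)) + Polynomial.C (X j) := by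
        simp [e, T, finSuccEquiv_X_succ, finSuccEquiv_X_zero, Fin.succ_ne_zero, add_comm]
      rw [h]
      exact ⟨Polynomial.monic_X_pow_add_C _ (pow_pos (by omega) _).ne',
        Polynomial.natDegree_X_pow_add_C⟩
  have hmon (v) : (e (monomial v 1)).Monic ∧ (e (monomial v 1)).natDegree = w v := by
    have h : e (monomial v 1) = ∏ i, e (X i) ^ v i := by
      rw [monomial_eq, Finsupp.prod_fintype _ _ (by simp)]
      simp
    rw [h]
    refine ⟨Polynomial.monic_prod_of_monic _ _ fun i _ ↦ (hX i).1.pow _, ?_⟩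
    rw [Polynomial.natDegree_prod_of_monic _ _ fun i _ ↦ (hX i).1.pow _]
    refine Finset.sum_congr rfl fun i _ ↦ ?_
    rw [(hX i).1.natDegree_pow, (hX i).2, mul_comm]
  have hlt {v} (hv : v ∈ f.support) (i) : v i < u :=
    ((monomial_le_degreeOf i hv).trans (degreeOf_le_totalDegree f i)).trans_lt (by omega)
  -- The exponents of the monomials of `f` are the digits of their weights in base `u`.
  have hw {v v'} (hv : v ∈ f.support) (hv' : v' ∈ f.support) (h : w v = w v') : v = v' := by
    refine Finsupp.ext <| congrFun <| List.ofFn_inj.mp ?_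
    apply Nat.ofDigits_inj_of_len_eq (b := u) (by omega) (by simp)
      (by simpa only [List.forall_mem_ofFn_iff] using hlt hv)
      (by simpa only [List.forall_mem_ofFn_iff] using hlt hv')
    simpa only [Nat.ofDigits_eq_sum_mapIdx, List.mapIdx_eq_ofFn, List.get_ofFn, List.length_ofFn,
      Fin.val_cast, mul_comm, List.sum_ofFn] using! h
  obtain ⟨v, hv, hmax⟩ := Finset.exists_max_image f.support w (support_nonempty.mpr hf)
  have hef : e f = ∑ v' ∈ f.support, coeff v' f • e (monomial v' 1) := by
    conv_lhs => rw [f.as_sum, map_sum]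
    refine Finset.sum_congr rfl fun v' _ ↦ ?_
    rw [← map_smul, smul_monomial, smul_eq_mul, mul_one]
  have hdeg : (e f).natDegree ≤ w v := by
    rw [hef]
    refine Polynomial.natDegree_sum_le_of_forall_le _ _ fun v' hv' ↦ ?_
    exact (Polynomial.natDegree_smul_le _ _).trans ((hmon v').2.trans_le (hmax v' hv'))
  have hcoeff : (e f).coeff (w v) = C (coeff v f) := by
    rw [hef, Polynomial.finsetSum_coeff, Finset.sum_eq_single_of_mem v hv]
    · rw [Polynomial.coeff_smul, ← (hmon v).2, (hmon v).1.coeff_natDegree, smul_eq_C_mul, mul_one]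
    · intro v' hv' hne
      rw [Polynomial.coeff_smul, Polynomial.coeff_eq_zero_of_natDegree_lt, smul_zero]
      rw [(hmon v').2]
      exact (hmax v' hv').lt_of_ne fun h ↦ hne (hw hv' hv h)
  have hunit : IsUnit (C (coeff v f) : MvPolynomial (Fin n) K) :=
    (mem_support_iff.mp hv).isUnit.map C
  refine ⟨e, ?_⟩
  rwa [Polynomial.leadingCoeff, le_antisymm hdeg (Polynomial.le_natDegree_of_ne_zero
    (hcoeff ▸ hunit.ne_zero)), hcoeff]

open Polynomial in
/-- A polynomial whose leading coefficient is a unit remains a non-zero-divisor modulo every ideal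
that is extended from the coefficient ring. -/
theorem mem_map_C_of_mul_mem {E : Type*} [CommRing E] {Q : Ideal E} {c : E[X]}
    (hc : IsUnit c.leadingCoeff) {z : E[X]} (h : c * z ∈ Q.map C) : z ∈ Q.map C := by
  have hker : RingHom.ker (mapRingHom (Ideal.Quotient.mk Q)) = Q.map C := by
    rw [ker_mapRingHom, Ideal.mk_ker]
  rw [← hker, RingHom.mem_ker] at h ⊢
  rw [map_mul] at h
  have hu : IsUnit (mapRingHom (Ideal.Quotient.mk Q) c).leadingCoeff := by
    rcases subsingleton_or_nontrivial (E ⧸ Q) with _ | _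
    · exact isUnit_of_subsingleton _
    · have hd : (Ideal.Quotient.mk Q) c.leadingCoeff ≠ 0 := (hc.map _).ne_zero
      rw [coe_mapRingHom, leadingCoeff_map_of_leadingCoeff_ne_zero _ hd]
      exact hc.map _
  obtain ⟨r, hr⟩ := hu.exists_left_inv
  by_contra hz
  have hz' : (mapRingHom (Ideal.Quotient.mk Q) z).leadingCoeff ≠ 0 := leadingCoeff_ne_zero.2 hz
  have h0 := congrArg (fun q ↦ q.coeff ((mapRingHom (Ideal.Quotient.mk Q) c).natDegree +
    (mapRingHom (Ideal.Quotient.mk Q) z).natDegree)) h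
  rw [coeff_mul_degree_add_degree, coeff_zero] at h0
  exact hz' (by rw [← one_mul (leadingCoeff _), ← hr, mul_assoc, h0, mul_zero])

/-- The elements `a, b, c` of `A` form a weakly regular sequence on the `A`-module `M`: `a` acts
injectively on `M`, `b` on `M ⧸ a M`, and `c` on `M ⧸ (a M + b M)`. The conditions are spelled out
as divisibility statements; `M ⧸ (a M + b M)` may be zero. -/
structure IsRegularTriple {A : Type*} [CommRing A] (M : Type*) [AddCommGroup M] [Module A M]
    (a b c : A) : Prop where
  smul_right_injective : ∀ x : M, a • x = 0 → x = 0
  exists_of_smul_eq : ∀ x y : M, a • x = b • y → ∃ z, y = a • z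
  exists_of_smul_eq_add : ∀ x y z : M, c • z = a • x + b • y → ∃ x' y', z = a • x' + b • y'

theorem IsRegularTriple.of_free {A : Type*} [CommRing A] {M : Type*} [AddCommGroup M] [Module A M]
    [Module.Free A M] {a b c : A} (h : IsRegularTriple A a b c) : IsRegularTriple M a b c := by
  classical
  let B := Module.Free.chooseBasis A M
  refine ⟨fun x hx ↦ ?_, fun x y hxy ↦ ?_, fun x y z hxyz ↦ ?_⟩
  · refine B.ext_elem fun i ↦ ?_
    simpa using h.1 (B.repr x i) (by simpa using congrArg (B.repr · i) hx)
  · have h' (i) := h.2 (B.repr x i) (B.repr y i) (by simpa using congrArg (B.repr · i) hxy)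
    choose z hz using h'
    refine ⟨∑ i ∈ (B.repr y).support, z i • B i, ?_⟩
    conv_lhs => rw [← B.linearCombination_repr y, Finsupp.linearCombination_apply, Finsupp.sum]
    rw [Finset.smul_sum]
    exact Finset.sum_congr rfl fun i _ ↦ by rw [hz i, smul_assoc]
  · have h' (i) := h.3 (B.repr x i) (B.repr y i) (B.repr z i)
      (by simpa using congrArg (B.repr · i) hxyz)
    choose x' y' hz using h'
    refine ⟨∑ i ∈ (B.repr z).support, x' i • B i, ∑ i ∈ (B.repr z).support, y' i • B i, ?_⟩
    conv_lhs => rw [← B.linearCombination_repr z, Finsupp.linearCombination_apply, Finsupp.sum]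
    rw [Finset.smul_sum, Finset.smul_sum, ← Finset.sum_add_distrib]
    exact Finset.sum_congr rfl fun i _ ↦ by rw [hz i, add_smul, smul_assoc, smul_assoc]

open Polynomial in
theorem isRegularTriple_polynomial {D : Type*} [CommRing D] [IsDomain D] {a : D} (ha : a ≠ 0)
    {b : D[X]} (hb : IsUnit b.leadingCoeff) {c : D[X][X]} (hc : IsUnit c.leadingCoeff) :
    IsRegularTriple D[X][X] (C (C a)) (C b) c := by
  have hspan : (Ideal.span {C a, b}).map C = Ideal.span {C (C a), C b} := by
    rw [Ideal.map_span, Set.image_pair]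
  refine ⟨fun x hx ↦ ?_, fun x y hxy ↦ ?_, fun x y z hxyz ↦ ?_⟩
  · exact (mul_eq_zero.1 hx).resolve_left (by simpa using ha)
  · simp only [smul_eq_mul] at hxy ⊢
    have key (i) : C a ∣ y.coeff i := by
      have h1 := congrArg (·.coeff i) hxy
      simp only [coeff_C_mul] at h1
      have h2 : b * y.coeff i ∈ (Ideal.span {a}).map C := by
        rw [Ideal.map_span, Set.image_singleton, ← h1]
        exact Ideal.mem_span_singleton.2 (dvd_mul_right _ _)
      have h3 := mem_map_C_of_mul_mem hb h2
      rwa [Ideal.map_span, Set.image_singleton, Ideal.mem_span_singleton] at h3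
    exact (C_dvd_iff_dvd_coeff _ _).2 key
  · simp only [smul_eq_mul] at hxyz ⊢
    have h2 : c * z ∈ (Ideal.span {C a, b}).map C := by
      rw [hspan, hxyz]
      exact Ideal.mem_span_pair.2 ⟨x, y, by ring⟩
    have h3 := mem_map_C_of_mul_mem hc h2
    rw [hspan] at h3
    obtain ⟨x', y', h⟩ := Ideal.mem_span_pair.1 h3
    exact ⟨x', y', by rw [← h]; ring⟩

theorem IsRegularTriple.of_ringEquiv {A B : Type*} [CommRing A] [CommRing B] (e : A ≃+* B)
    {a b c : A} (h : IsRegularTriple B (e a) (e b) (e c)) : IsRegularTriple A a b c := by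
  obtain ⟨h1, h2, h3⟩ := h
  simp only [smul_eq_mul] at h1 h2 h3
  refine ⟨fun x hx ↦ ?_, fun x y hxy ↦ ?_, fun x y z hxyz ↦ ?_⟩
  · exact e.map_eq_zero_iff.1 (h1 (e x) (by simpa using congrArg e hx))
  · obtain ⟨z, hz⟩ := h2 (e x) (e y) (by simpa using congrArg e hxy)
    exact ⟨e.symm z, e.injective (by simpa using hz)⟩
  · obtain ⟨x', y', h⟩ := h3 (e x) (e y) (e z) (by simpa using congrArg e hxyz)
    exact ⟨e.symm x', e.symm y', e.injective (by simpa using h)⟩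

open Polynomial in
/-- An ideal `J` of a polynomial ring in `m + 2` variables contains a regular sequence of length
three if any `m` elements are algebraically dependent modulo `J` (that is, if `J` has height at
least three). -/
theorem exists_isRegularTriple_of_algebraic_mod {K A : Type*} [Field K] [CommRing A] [Algebra K A]
    {m : ℕ} (e : A ≃ₐ[K] MvPolynomial (Fin (m + 2)) K) (J : Ideal A)
    (hJ : ∀ y : Fin m → A, ∃ P : MvPolynomial (Fin m) K, P ≠ 0 ∧ MvPolynomial.aeval y P ∈ J) :
    ∃ a ∈ J, ∃ b ∈ J, ∃ c ∈ J, IsRegularTriple A a b c := by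
  -- `J` meets every polynomial subring in at least `m` variables nontrivially.
  have step {l : ℕ} (hl : m ≤ l) (i : MvPolynomial (Fin l) K →ₐ[K] A) :
      ∃ f : MvPolynomial (Fin l) K, f ≠ 0 ∧ i f ∈ J := by
    obtain ⟨P, hP, hPJ⟩ := hJ fun j ↦ i (MvPolynomial.X (Fin.castLE hl j))
    refine ⟨MvPolynomial.rename (Fin.castLE hl) P, ?_, ?_⟩
    · exact fun h ↦ hP (MvPolynomial.rename_injective _ (Fin.castLE_injective hl)
        (h.trans (map_zero _).symm))
    · have h : i.comp (MvPolynomial.rename (Fin.castLE hl)) =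
          MvPolynomial.aeval fun j ↦ i (MvPolynomial.X (Fin.castLE hl j)) := by
        ext j
        simp
      rwa [← AlgHom.comp_apply, h]
  obtain ⟨c, hc, hcJ⟩ := step (by omega) e.symm.toAlgHom
  obtain ⟨e₁, he₁⟩ := exists_algEquiv_isUnit_leadingCoeff hc
  let i₁ : MvPolynomial (Fin (m + 1)) K →ₐ[K] A :=
    (e.trans e₁).symm.toAlgHom.comp (Polynomial.CAlgHom)
  -- Up to a unit, `e₁ c` is monic in the outer variable; `b` does not involve that variable.
  obtain ⟨b, hb, hbJ⟩ := step (by omega) i₁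
  obtain ⟨e₂, he₂⟩ := exists_algEquiv_isUnit_leadingCoeff hb
  let i₂ : MvPolynomial (Fin m) K →ₐ[K] A :=
    i₁.comp (e₂.symm.toAlgHom.comp (Polynomial.CAlgHom))
  -- `a` does not involve the outer variable of `e₂` either, in which `e₂ b` is monic up to a unit.
  obtain ⟨a, ha, haJ⟩ := step le_rfl i₂
  refine ⟨_, haJ, _, hbJ, _, hcJ, ?_⟩
  let E := (e.trans e₁).trans (Polynomial.mapAlgEquiv e₂)
  have hEa : E (i₂ a) = C (C a) := by simp [E, i₂, i₁]
  have hEb : E (i₁ b) = C (e₂ b) := by simp [E, i₁]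
  have hEc : E (e.symm c) = (e₁ c).map (e₂ : _ →+* _) := by simp [E]
  refine IsRegularTriple.of_ringEquiv (B := (MvPolynomial (Fin m) K)[X][X]) E.toRingEquiv ?_
  have key := isRegularTriple_polynomial ha he₂ (c := (e₁ c).map (e₂ : _ →+* _)) <| by
    rw [leadingCoeff_map_of_injective e₂.injective]
    exact he₁.map _
  rw [← hEa, ← hEb, ← hEc] at key
  exact key

/-! ### The annihilator of a class in `H¹(G, B)` -/

open Polynomial in
/-- Two homomorphisms from `R` to a domain that agree on the invariants of a finite group `Γ` differ
by an element of `Γ`. -/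
theorem exists_forall_eq_comp_smul {Γ R D : Type*} [Group Γ] [Finite Γ] [CommRing R]
    [MulSemiringAction Γ R] [CommRing D] [IsDomain D] (φ ψ : R →+* D)
    (h : ∀ r : R, (∀ γ : Γ, γ • r = r) → φ r = ψ r) : ∃ γ : Γ, ∀ x, φ x = ψ (γ • x) := by
  classical
  cases nonempty_fintype Γ
  by_contra! hne
  choose x hx using hne
  -- Pack the counterexamples for all `γ` into the coefficients of a single polynomial `r`. The
  -- characteristic polynomial of `r` has `Γ`-invariant coefficients, so `φ r` is a root of its
  -- image under `ψ`, which is a product of the factors `Y - ψ (γ • r)`.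
  let e := Fintype.equivFin Γ
  let r : R[X] := ∑ γ, monomial (e γ : ℕ) (x γ)
  have hr (γ) : r.coeff (e γ) = x γ := by
    simp only [r, finsetSum_coeff, coeff_monomial]
    rw [Finset.sum_eq_single γ] <;> simp +contextual [Fin.val_inj]
  have hmap : (MulSemiringAction.charpoly Γ r).map (mapRingHom φ) =
      (MulSemiringAction.charpoly Γ r).map (mapRingHom ψ) := by
    ext i j
    simp only [coeff_map, coe_mapRingHom]
    refine h _ fun γ ↦ ?_
    rw [← coeff_smul, MulSemiringAction.smul_coeff_charpoly]
  have heval := congrArg (eval (r.map φ)) hmap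
  rw [← coe_mapRingHom, eval_map_apply, MulSemiringAction.eval_charpoly, map_zero,
    MulSemiringAction.charpoly_eq, Polynomial.map_prod, eval_prod, eq_comm,
    Finset.prod_eq_zero_iff] at heval
  obtain ⟨γ, -, hγ⟩ := heval
  have h1 : r.map φ = (γ • r).map ψ := by simpa [sub_eq_zero] using hγ
  have h2 := congrArg (·.coeff (e γ : ℕ)) h1
  simp only [coeff_map, coeff_smul, hr] at h2
  exact hx γ h2

section Annihilator

variable {p : ℕ} {G B : Type*} [Group G] [CommRing B] [MulSemiringAction G B]

theorem smul_zmod_ringHom (c : ZMod p →+* B) (σ : G) (k : ZMod p) : σ • c k = c k :=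
  RingHom.congr_fun (Subsingleton.elim ((MulSemiringAction.toRingHom G B σ).comp c) c) k

/-- The annihilator in `A` of the class in `H¹(G, B)` of the cocycle `c ∘ χ`, for a homomorphism
`χ` from `G` to the additive group of `ℤ/p`, written multiplicatively, and the structure map
`c : ℤ/p → B`: the elements `a` such that `σ ↦ c (χ σ) * a` is a coboundary. -/
def cocycleAnnihilator (A : Type*) [CommRing A] [Algebra A B] [SMulCommClass G A B]
    (χ : G →* Multiplicative (ZMod p)) (c : ZMod p →+* B) : Ideal A where
  carrier := {a | ∃ b : B, ∀ σ : G, σ • b - b = c (χ σ).toAdd * algebraMap A B a}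
  zero_mem' := ⟨0, by simp⟩
  add_mem' := by
    rintro a a' ⟨b, hb⟩ ⟨b', hb'⟩
    refine ⟨b + b', fun σ ↦ ?_⟩
    rw [smul_add, map_add, mul_add, ← hb, ← hb']
    ring
  smul_mem' := by
    rintro a a' ⟨b, hb⟩
    refine ⟨a • b, fun σ ↦ ?_⟩
    rw [smul_comm, ← smul_sub, hb, smul_eq_mul, map_mul, Algebra.smul_def]
    ring

variable {A : Type*} [CommRing A] [Algebra A B]

theorem smul_smul_section {χ : G →* Multiplicative (ZMod p)} {g : ZMod p → G}
    (hg : ∀ k, (χ (g k)).toAdd = k) {s : B} (hs : ∀ ν ∈ χ.ker, ν • s = s) (σ : G) (k : ZMod p) :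
    σ • g k • s = g ((χ σ).toAdd + k) • s := by
  have h := hs ((g ((χ σ).toAdd + k))⁻¹ * (σ * g k)) <| by
    rw [MonoidHom.mem_ker, ← toAdd_eq_zero]
    simp [hg]
  rw [mul_smul, inv_smul_eq_iff, mul_smul] at h
  exact h

/-- Relative traces of `ker χ`-invariant elements annihilate the class of `χ`; here `g` is a section
of `χ`. -/
theorem mem_cocycleAnnihilator_of_trace [NeZero p] [SMulCommClass G A B]
    {χ : G →* Multiplicative (ZMod p)}
    {c : ZMod p →+* B} {g : ZMod p → G} (hg : ∀ k, (χ (g k)).toAdd = k) {s : B}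
    (hs : ∀ ν ∈ χ.ker, ν • s = s) {a : A} (ha : algebraMap A B a = ∑ k, g k • s) :
    a ∈ cocycleAnnihilator A χ c := by
  refine ⟨-∑ k, c k * g k • s, fun σ ↦ ?_⟩
  have h1 : σ • ∑ k, c k * g k • s = ∑ k, c (k - (χ σ).toAdd) * g k • s := by
    rw [Finset.smul_sum, ← Equiv.sum_comp (Equiv.addLeft (χ σ).toAdd)
      fun k ↦ c (k - (χ σ).toAdd) * g k • s]
    refine Finset.sum_congr rfl fun k _ ↦ ?_
    rw [smul_mul', smul_zmod_ringHom, smul_smul_section hg hs]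
    simp
  rw [smul_neg, h1, ha, Finset.mul_sum, neg_sub_neg, ← Finset.sum_sub_distrib]
  refine Finset.sum_congr rfl fun k _ ↦ ?_
  rw [map_sub]
  ring

/-- An invariant lies in the radical of the annihilator if, for every `σ ∉ ker χ`, it vanishes on
the fixed locus of `σ`, which is defined by the ideal generated by all `σ • b - b`. -/
theorem mem_radical_cocycleAnnihilator [Fact p.Prime] [Finite G] [SMulCommClass G A B]
    [Algebra.IsInvariant A B G]
    {χ : G →* Multiplicative (ZMod p)} (hχ : Function.Surjective χ) (c : ZMod p →+* B)
    {f : A} (hf : ∀ σ ∉ χ.ker,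
      algebraMap A B f ∈ Ideal.span (Set.range fun b : B ↦ σ • b - b)) :
    f ∈ (cocycleAnnihilator A χ c).radical := by
  obtain ⟨g, hg⟩ : ∃ g : ZMod p → G, ∀ k, (χ (g k)).toAdd = k :=
    ⟨_, fun k ↦ congrArg Multiplicative.toAdd
      (Function.surjInv_eq hχ (Multiplicative.ofAdd k))⟩
  rw [Ideal.radical_eq_sInf, Ideal.mem_sInf]
  rintro P ⟨hP, hPprime⟩
  have := Algebra.IsInvariant.isIntegral A B G
  obtain ⟨Q, hQ, hQP⟩ := Ideal.exists_ideal_over_prime_of_isIntegral P (⊥ : Ideal B) <| by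
    intro a ha
    refine hP (mem_cocycleAnnihilator_of_trace hg (s := 0) (by simp) ?_)
    simpa using ha
  obtain ⟨hQprime, hQP⟩ := hQP
  let S : Submonoid B :=
    { carrier := {s | ∀ ν ∈ χ.ker, ν • s = s}
      one_mem' := fun ν _ ↦ smul_one ν
      mul_mem' := fun hs ht ν hν ↦ by rw [smul_mul', hs ν hν, ht ν hν] }
  let φ (σ : G) : B →+* B ⧸ Q := (Ideal.Quotient.mk Q).comp (MulSemiringAction.toRingHom G B σ)
  let θ (k : ZMod p) : S →* B ⧸ Q := (φ (g k) : B →* B ⧸ Q).comp S.subtype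
  have hθ (s : S) : ∑ k, θ k s = 0 := by
    obtain ⟨a, ha⟩ := Algebra.IsInvariant.isInvariant (A := A) (G := G) (∑ k, g k • (s : B)) <| by
      intro σ
      rw [Finset.smul_sum, ← Equiv.sum_comp (Equiv.addLeft (χ σ).toAdd) fun k ↦ g k • (s : B)]
      exact Finset.sum_congr rfl fun k _ ↦ smul_smul_section hg s.2 σ k
    have haP : a ∈ P := hP (mem_cocycleAnnihilator_of_trace hg s.2 ha)
    rw [← hQP, Ideal.mem_comap, ha] at haP
    simpa [θ, φ] using Ideal.Quotient.eq_zero_iff_mem.2 haP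
  -- By Dedekind's independence of characters the `θ k` cannot be distinct.
  obtain ⟨i, j, hij, hne⟩ : ∃ i j, θ i = θ j ∧ i ≠ j := by
    by_contra! hinj
    have hli := (linearIndependent_monoidHom S (B ⧸ Q)).comp θ fun i j ↦ hinj i j
    rw [Fintype.linearIndependent_iff] at hli
    exact one_ne_zero (hli (fun _ ↦ 1) (funext fun s ↦ by simpa using hθ s) 0)
  -- Hence `g i` and `g j` agree on `B` modulo `Q` up to an element `ν` of `ker χ`.
  obtain ⟨ν, hν⟩ := exists_forall_eq_comp_smul (Γ := χ.ker) (φ (g i)) (φ (g j)) fun s hs ↦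
    DFunLike.congr_fun hij ⟨s, fun ν hν ↦ hs ⟨ν, hν⟩⟩
  have hρ : g j * ν * (g i)⁻¹ ∉ χ.ker := by
    have h0 : χ (ν : G) = 1 := ν.2
    rw [MonoidHom.mem_ker, ← toAdd_eq_zero]
    simpa [hg, h0, add_neg_eq_zero] using hne.symm
  rw [← hQP, Ideal.mem_comap]
  refine Ideal.span_le.2 ?_ (hf _ hρ)
  rintro _ ⟨b, rfl⟩
  have h := hν ((g i)⁻¹ • b)
  rw [SetLike.mem_coe, ← Ideal.Quotient.eq_zero_iff_mem, map_sub, sub_eq_zero]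
  simpa [φ, mul_smul, Subgroup.smul_def] using h.symm

end Annihilator

/-! ### A regular sequence in the annihilator trivializes the class -/

theorem IsRegularTriple.algebraMap_of_free {A₀ A : Type*} [CommRing A₀] [CommRing A]
    [Algebra A₀ A] [Module.Free A₀ A] {a b c : A₀} (h : IsRegularTriple A₀ a b c) :
    IsRegularTriple A (algebraMap A₀ A a) (algebraMap A₀ A b) (algebraMap A₀ A c) := by
  obtain ⟨h1, h2, h3⟩ := h.of_free (M := A)
  simp only [Algebra.smul_def] at h1 h2 h3
  exact ⟨h1, h2, h3⟩

section Coprime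

theorem pow_dvd_of_pow_dvd_pow_mul {A : Type*} [CommRing A] [IsDomain A] {a b : A} (ha : a ≠ 0)
    (hab : ∀ x y, a * x = b * y → a ∣ y) (k l : ℕ) {y : A} (h : a ^ k ∣ b ^ l * y) : a ^ k ∣ y := by
  have step (k : ℕ) : ∀ {y : A}, a ^ k ∣ b * y → a ^ k ∣ y := by
    induction k with
    | zero => simp
    | succ k ih =>
      rintro y ⟨x, hx⟩
      obtain ⟨y, rfl⟩ := hab (a ^ k * x) y (by rw [hx]; ring)
      rw [pow_succ']
      refine mul_dvd_mul_left a (ih ⟨x, mul_left_cancel₀ ha ?_⟩)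
      linear_combination hx
  induction l generalizing y with
  | zero => simpa using h
  | succ l ih => exact step k (ih (by rwa [pow_succ, mul_assoc] at h))

variable {A B : Type*} [CommRing A] [IsDomain A] [CommRing B] [Algebra A B]
  [FaithfulSMul A B]

/-- If `a, b` is a regular sequence in the ring of invariants `A`, then `a` and `b` are coprime in
`B`: the norm of a common divisor divides powers of `a` and of `b` in `A`, so it is a unit. -/
theorem isRelPrime_algebraMap_of_isInvariant (G : Type*) [Group G] [Finite G]
    [MulSemiringAction G B] [SMulCommClass G A B] [Algebra.IsInvariant A B G] {a b : A} (ha : a ≠ 0)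
    (hab : ∀ x y, a * x = b * y → a ∣ y) :
    IsRelPrime (algebraMap A B a) (algebraMap A B b) := by
  classical
  cases nonempty_fintype G
  intro d hda hdb
  have norm (x : B) : ∃ y : A, algebraMap A B y = ∏ g : G, g • x :=
    Algebra.IsInvariant.isInvariant (A := A) (G := G) _ fun g ↦ by
      rw [Finset.smul_prod']
      simp only [smul_smul]
      exact Fintype.prod_equiv (Equiv.mulLeft g) _ _ fun _ ↦ rfl
  obtain ⟨D, hD⟩ := norm d
  have hdvd {e : A} (h : d ∣ algebraMap A B e) : D ∣ e ^ Fintype.card G := by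
    obtain ⟨x, hx⟩ := h
    obtain ⟨y, hy⟩ := norm x
    refine ⟨y, FaithfulSMul.algebraMap_injective A B ?_⟩
    rw [map_mul, hD, hy, ← Finset.prod_mul_distrib, map_pow]
    simp only [← smul_mul', ← hx, smul_algebraMap, Finset.prod_const, Finset.card_univ]
  obtain ⟨u, hu⟩ := hdvd hda
  obtain ⟨v, hv⟩ := hdvd hdb
  obtain ⟨w, hw⟩ := pow_dvd_of_pow_dvd_pow_mul ha hab (Fintype.card G) (Fintype.card G) (y := u)
    ⟨v, by rw [hu, hv]; ring⟩
  have hDunit : IsUnit D := .of_mul_eq_one w <| mul_left_cancel₀ (pow_ne_zero (Fintype.card G) ha)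
    (by linear_combination (-1 : A) * hu + (-D) * hw)
  have hNunit := hDunit.map (algebraMap A B)
  rw [hD] at hNunit
  refine isUnit_of_dvd_unit ?_ hNunit
  simpa using Finset.dvd_prod_of_mem (fun g : G ↦ g • d) (Finset.mem_univ 1)

/-- If three elements that form a regular sequence in the ring of invariants annihilate the class of
a cocycle, then the class is zero. -/
theorem one_mem_cocycleAnnihilator_of_isRegularTriple [IsDomain B] [DecompositionMonoid B] {G : Type*} [Group G]
    [Finite G] [MulSemiringAction G B] [SMulCommClass G A B] [Algebra.IsInvariant A B G] {p : ℕ}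
    {χ : G →* Multiplicative (ZMod p)} {c : ZMod p →+* B} {f₁ f₂ f₃ : A}
    (hf : IsRegularTriple A f₁ f₂ f₃)
    (h₁ : f₁ ∈ cocycleAnnihilator A χ c) (h₂ : f₂ ∈ cocycleAnnihilator A χ c)
    (h₃ : f₃ ∈ cocycleAnnihilator A χ c) : 1 ∈ cocycleAnnihilator A χ c := by
  have hinj := FaithfulSMul.algebraMap_injective A B
  obtain ⟨b₁, hb₁⟩ := h₁
  obtain ⟨b₂, hb₂⟩ := h₂
  obtain ⟨b₃, hb₃⟩ := h₃
  have hne : f₁ ≠ 0 := by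
    rintro rfl
    exact one_ne_zero (hf.smul_right_injective 1 (by simp))
  have minor {f f' : A} {b b' : B}
      (hb : ∀ σ : G, σ • b - b = c (χ σ).toAdd * algebraMap A B f)
      (hb' : ∀ σ : G, σ • b' - b' = c (χ σ).toAdd * algebraMap A B f') :
      ∃ u : A, algebraMap A B u = algebraMap A B f * b' - algebraMap A B f' * b :=
    Algebra.IsInvariant.isInvariant (A := A) (G := G) _ fun σ ↦ by
      rw [smul_sub, smul_mul', smul_mul', smul_algebraMap, smul_algebraMap]
      linear_combination algebraMap A B f * hb' σ - algebraMap A B f' * hb σ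
  obtain ⟨u₁₂, hu₁₂⟩ := minor hb₁ hb₂
  obtain ⟨u₁₃, hu₁₃⟩ := minor hb₁ hb₃
  obtain ⟨u₂₃, hu₂₃⟩ := minor hb₂ hb₃
  obtain ⟨x, y, hxy⟩ := hf.exists_of_smul_eq_add (-u₂₃) u₁₃ u₁₂ <| hinj <| by
    simp only [smul_eq_mul, map_mul, map_add, map_neg, hu₁₂, hu₁₃, hu₂₃]
    ring
  simp only [smul_eq_mul] at hxy
  have hxy' := congrArg (algebraMap A B) hxy
  rw [hu₁₂, map_add, map_mul, map_mul] at hxy'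
  have hrel := isRelPrime_algebraMap_of_isInvariant (B := B) G hne
    (fun x y h ↦ hf.exists_of_smul_eq x y h)
  obtain ⟨z, hz⟩ := hrel.dvd_of_dvd_mul_left (z := b₁ + algebraMap A B y)
    ⟨b₂ - algebraMap A B x, by linear_combination -hxy'⟩
  refine ⟨z, fun σ ↦ mul_left_cancel₀ ((map_ne_zero_iff _ hinj).2 hne) ?_⟩
  have hσ := congrArg (σ • ·) hz
  simp only [smul_add, smul_mul', smul_algebraMap] at hσ
  rw [map_one]
  linear_combination hb₁ σ - hσ + hz

end Coprime

/-! ### Algebraic dependence on a fixed locus -/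

section AlgebraicDependence

open MvPolynomial

theorem exists_aeval_eq_zero_of_finrank_lt {K Q : Type*} [Field K] [CommRing Q] [Algebra K Q]
    (W : Submodule K Q) [FiniteDimensional K W] (hW : Algebra.adjoin K (W : Set Q) = ⊤) {m : ℕ}
    (hm : Module.finrank K W < m) (y : Fin m → Q) :
    ∃ P : MvPolynomial (Fin m) K, P ≠ 0 ∧ aeval y P = 0 := by
  by_contra! h
  have hy : AlgebraicIndependent K y := (injective_iff_map_eq_zero _).2 fun P hP ↦ by
    by_contra hP'
    exact h P hP' hP
  let e := Module.finBasis K W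
  let φ : MvPolynomial (Fin (Module.finrank K W)) K →ₐ[K] Q := aeval fun i ↦ (e i : Q)
  have hφ : Function.Surjective φ := by
    rw [← AlgHom.range_eq_top, eq_top_iff, ← hW, Algebra.adjoin_le_iff]
    intro w hw
    have hsum := congrArg W.subtype (e.sum_repr ⟨w, hw⟩)
    rw [map_sum] at hsum
    simp only [map_smul, Submodule.subtype_apply] at hsum
    rw [← hsum]
    refine sum_mem fun i _ ↦ ?_
    exact Subalgebra.smul_mem φ.range (AlgHom.mem_range φ |>.2 ⟨X i, by simp [φ]⟩) _
  have h1 := hy.lift_cardinalMk_le_trdeg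
  have h2 := lift_trdeg_le_of_surjective φ hφ
  rw [MvPolynomial.trdeg_of_isDomain] at h2
  simp only [Cardinal.mk_fin, Cardinal.lift_natCast, Cardinal.lift_le_nat_iff,
    Cardinal.lift_id'] at h1 h2
  exact hm.not_ge (by exact_mod_cast h1.trans h2)

end AlgebraicDependence

open MvPolynomial in
/-- If the ring of invariants `A` is free over a polynomial ring in `m + 2` variables, and any `m`
elements of `B` are algebraically dependent on the fixed locus of each `σ ∉ ker χ`, then the class
of `χ` in `H¹(G, B)` is zero. -/
theorem one_mem_cocycleAnnihilator_of_free {K A₀ A B G : Type*} [Field K] [CommRing A₀] [CommRing A]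
    [IsDomain A] [CommRing B] [IsDomain B] [DecompositionMonoid B] [Algebra K A₀] [Algebra K A]
    [Algebra K B] [Algebra A₀ A] [Algebra A B] [IsScalarTower K A₀ A] [IsScalarTower K A B]
    [FaithfulSMul A B] [Module.Free A₀ A] [Group G] [Finite G] [MulSemiringAction G B]
    [SMulCommClass G A B] [Algebra.IsInvariant A B G] {p : ℕ} [Fact p.Prime]
    {χ : G →* Multiplicative (ZMod p)} (hχ : Function.Surjective χ) (c : ZMod p →+* B) {m : ℕ}
    (e : A₀ ≃ₐ[K] MvPolynomial (Fin (m + 2)) K)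
    (h : ∀ σ ∉ χ.ker, ∀ y : Fin m → B, ∃ P : MvPolynomial (Fin m) K, P ≠ 0 ∧
      aeval y P ∈ Ideal.span (Set.range fun b : B ↦ σ • b - b)) :
    1 ∈ cocycleAnnihilator A χ c := by
  classical
  cases nonempty_fintype G
  obtain ⟨a₁, h₁, a₂, h₂, a₃, h₃, hreg⟩ := exists_isRegularTriple_of_algebraic_mod e
    ((cocycleAnnihilator A χ c).comap (algebraMap A₀ A)) <| by
    intro y
    let ι : A₀ →ₐ[K] B := (IsScalarTower.toAlgHom K A B).comp (IsScalarTower.toAlgHom K A₀ A)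
    have hP (σ : G) : ∃ P : MvPolynomial (Fin m) K, P ≠ 0 ∧ (σ ∉ χ.ker →
        aeval (fun i ↦ ι (y i)) P ∈ Ideal.span (Set.range fun b : B ↦ σ • b - b)) := by
      by_cases hσ : σ ∈ χ.ker
      · exact ⟨1, one_ne_zero, fun h ↦ absurd hσ h⟩
      · obtain ⟨P, hP, hP'⟩ := h σ hσ fun i ↦ ι (y i)
        exact ⟨P, hP, fun _ ↦ hP'⟩
    choose P hP0 hP using hP
    -- The product of the relations for the various `σ` is a relation on all fixed loci.
    obtain ⟨k, hk⟩ := mem_radical_cocycleAnnihilator hχ c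
      (f := algebraMap A₀ A (aeval y (∏ σ, P σ))) fun σ hσ ↦ by
        refine Ideal.mem_of_dvd _ ?_ (hP σ hσ)
        have hι : algebraMap A B (algebraMap A₀ A (aeval y (∏ σ, P σ))) =
            aeval (fun i ↦ ι (y i)) (∏ σ, P σ) := comp_aeval_apply (f := y) ι _
        rw [hι]
        exact map_dvd _ (Finset.dvd_prod_of_mem P (Finset.mem_univ σ))
    refine ⟨(∏ σ, P σ) ^ k, pow_ne_zero _ (Finset.prod_ne_zero_iff.2 fun σ _ ↦ hP0 σ), ?_⟩
    rwa [Ideal.mem_comap, map_pow, map_pow]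
  exact one_mem_cocycleAnnihilator_of_isRegularTriple hreg.algebraMap_of_free h₁ h₂ h₃

/-! ### The linear action on the polynomial ring -/

section PolyAction

open MvPolynomial

variable {K G : Type*} [Field K] [Group G] {n : ℕ} (ρ : G →* Matrix.GeneralLinearGroup (Fin n) K)

/-- The action `polyAction ρ` as a `MulSemiringAction`. It depends on `ρ`, so it is not a global
instance. -/
noncomputable abbrev polyMulSemiringAction : MulSemiringAction G (MvPolynomial (Fin n) K) where
  smul σ f := polyAction ρ σ f
  one_smul f := by change polyAction ρ 1 f = f; rw [map_one]; rfl
  mul_smul σ τ f := by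
    change polyAction ρ (σ * τ) f = polyAction ρ σ (polyAction ρ τ f); rw [map_mul]; rfl
  smul_zero σ := map_zero (polyAction ρ σ)
  smul_add σ := map_add (polyAction ρ σ)
  smul_one σ := map_one (polyAction ρ σ)
  smul_mul σ := map_mul (polyAction ρ σ)

theorem polyAction_linear (σ : G) (v : Fin n → K) :
    polyAction ρ σ (∑ i, v i • X i) =
      ∑ i, ((ρ σ : Matrix (Fin n) (Fin n) K).mulVec v) i • X i := by
  simp only [polyAction, MonoidHom.coe_mk, OneHom.coe_mk, map_sum, map_smul, aeval_X,
    Finset.smul_sum, smul_smul, Matrix.mulVec, dotProduct, Finset.sum_smul]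
  rw [Finset.sum_comm]
  simp only [mul_comm]

theorem constantCoeff_polyAction (σ : G) (f : MvPolynomial (Fin n) K) :
    constantCoeff (polyAction ρ σ f) = constantCoeff f := by
  have h : (constantCoeff : MvPolynomial (Fin n) K →+* K).comp (polyAction ρ σ).toRingHom =
      constantCoeff := by
    ext i <;> simp [polyAction, smul_eq_C_mul]
  exact RingHom.congr_fun h f

theorem finrank_quotient_fixedSpace_inv (σ : G) :
    Module.finrank K ((Fin n → K) ⧸ fixedSpace ρ σ⁻¹) =
      ((ρ σ : Matrix (Fin n) (Fin n) K) - 1).rank := by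
  have h : fixedSpace ρ σ⁻¹ =
      LinearMap.ker ((ρ σ : Matrix (Fin n) (Fin n) K) - 1).transpose.mulVecLin := by
    ext v
    simp [fixedSpace, pointAction, Matrix.transpose_sub, sub_eq_zero]
  rw [h, (LinearMap.quotKerEquivRange _).finrank_eq, ← Matrix.rank_transpose]
  rfl

variable {ρ} in
theorem IsBireflection.conj {σ : G} (h : IsBireflection ρ σ) (τ : G) :
    IsBireflection ρ (τ * σ * τ⁻¹) := by
  rw [IsBireflection, ← inv_inv (τ * σ * τ⁻¹), finrank_quotient_fixedSpace_inv]
  rw [IsBireflection, ← inv_inv σ, finrank_quotient_fixedSpace_inv] at h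
  have hconj : ((ρ (τ * σ * τ⁻¹)⁻¹ : Matrix (Fin n) (Fin n) K) - 1) =
      ρ τ * ((ρ σ⁻¹ : Matrix (Fin n) (Fin n) K) - 1) * ρ τ⁻¹ := by
    rw [mul_sub, sub_mul, mul_one, ← Units.val_mul, ← Units.val_mul, ← Units.val_mul, ← map_mul,
      ← map_mul, ← map_mul]
    simp [mul_assoc]
  rw [hconj]
  exact ((Matrix.rank_mul_le_left _ _).trans (Matrix.rank_mul_le_right _ _)).trans h

/-- If `V^σ` has codimension at least `3`, then the coordinate ring of the fixed locus of `σ` is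
generated by at most `n - 3` linear forms, so any `n - 2` polynomials are algebraically dependent on
it. The hypothesis concerns `σ⁻¹`, which has the same fixed space, because `pointAction ρ σ⁻¹` is
given by the transpose of the matrix `ρ σ`. -/
theorem exists_aeval_mem_span_polyAction_sub {σ : G} (hσ : ¬ IsBireflection ρ σ⁻¹) {m : ℕ}
    (hm : n ≤ m + 2) (y : Fin m → MvPolynomial (Fin n) K) :
    ∃ P : MvPolynomial (Fin m) K, P ≠ 0 ∧
      aeval y P ∈ Ideal.span (Set.range fun b ↦ polyAction ρ σ b - b) := by
  set I := Ideal.span (Set.range fun b ↦ polyAction ρ σ b - b)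
  let π := Ideal.Quotient.mkₐ K I
  let L : (Fin n → K) →ₗ[K] (MvPolynomial (Fin n) K ⧸ I) :=
    π.toLinearMap ∘ₗ Fintype.linearCombination K X
  have hker : LinearMap.range ((ρ σ : Matrix (Fin n) (Fin n) K) - 1).mulVecLin ≤
      LinearMap.ker L := by
    rintro _ ⟨v, rfl⟩
    have h : polyAction ρ σ (∑ i, v i • X i) - ∑ i, v i • X i ∈ I :=
      Ideal.subset_span ⟨_, rfl⟩
    rw [polyAction_linear, ← Finset.sum_sub_distrib] at h
    simp only [← sub_smul] at h
    rw [LinearMap.mem_ker]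
    refine Ideal.Quotient.eq_zero_iff_mem.2 ?_
    simpa [Fintype.linearCombination_apply, Matrix.sub_mulVec] using h
  have hadj : Algebra.adjoin K (LinearMap.range L : Set (MvPolynomial (Fin n) K ⧸ I)) = ⊤ := by
    rw [eq_top_iff, ← (AlgHom.range_eq_top π).2 (Ideal.Quotient.mkₐ_surjective K I),
      ← Algebra.map_top, ← MvPolynomial.adjoin_range_X, AlgHom.map_adjoin]
    refine Algebra.adjoin_mono ?_
    rintro _ ⟨_, ⟨i, rfl⟩, rfl⟩
    exact ⟨Pi.single i 1, by simp [L]⟩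
  have hrank : Module.finrank K (LinearMap.range L) < m := by
    have h1 := L.finrank_range_add_finrank_ker
    have h2 := Submodule.finrank_mono hker
    rw [IsBireflection, finrank_quotient_fixedSpace_inv, Matrix.rank] at hσ
    rw [Module.finrank_fin_fun] at h1
    omega
  obtain ⟨P, hP, h⟩ := exists_aeval_eq_zero_of_finrank_lt _ hadj hrank (π ∘ y)
  refine ⟨P, hP, Ideal.Quotient.eq_zero_iff_mem.1 ?_⟩
  rw [← h]
  exact comp_aeval_apply (f := y) π P

end PolyAction

open MvPolynomial

section InvariantRing

variable {K G : Type*} [Field K] [Group G] {n : ℕ} (ρ : G →* Matrix.GeneralLinearGroup (Fin n) K)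

theorem isInvariant_invariantRing :
    letI := polyMulSemiringAction ρ
    Algebra.IsInvariant (invariantRing ρ) (MvPolynomial (Fin n) K) G :=
  letI := polyMulSemiringAction ρ
  ⟨fun b hb ↦ ⟨⟨b, hb⟩, rfl⟩⟩

theorem smulCommClass_invariantRing :
    letI := polyMulSemiringAction ρ
    SMulCommClass G (invariantRing ρ) (MvPolynomial (Fin n) K) :=
  letI := polyMulSemiringAction ρ
  ⟨fun σ a b ↦ by
    have h : σ • (a : MvPolynomial (Fin n) K) = a := a.2 σ
    rw [Subalgebra.smul_def, Subalgebra.smul_def, smul_eq_mul, smul_eq_mul, smul_mul', h]⟩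

variable {ρ}

/-- The `n` members of an hsop are algebraically independent, as `R^G` is algebraic over the
subalgebra that they generate and has transcendence degree `n`. -/
theorem IsHsop.algebraicIndependent [Finite G] {f : Fin n → invariantRing ρ} (hf : IsHsop ρ f) :
    AlgebraicIndependent K f := by
  let := polyMulSemiringAction ρ
  have := isInvariant_invariantRing ρ
  have := hf.2
  have hint : Algebra.IsIntegral (invariantRing ρ) (MvPolynomial (Fin n) K) :=
    Algebra.IsInvariant.isIntegral _ _ G
  have h1 := trdeg_add_eq K (invariantRing ρ) (A := MvPolynomial (Fin n) K)
  rw [trdeg_eq_zero (R := invariantRing ρ), add_zero, MvPolynomial.trdeg_of_isDomain] at h1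
  have : Algebra.IsAlgebraic (Algebra.adjoin K (Set.range f)) (invariantRing ρ) := inferInstance
  refine (Algebra.IsAlgebraic.isTranscendenceBasis_of_lift_le_trdeg_of_finite K f ?_).1
  rw [h1]
  simp

end InvariantRing

/-! ### Cohen–Macaulay invariant rings -/

theorem theorem2p1 {K G : Type*} [Field K] [Group G] [Finite G] (p : ℕ) [Fact p.Prime]
    [CharP K p] (hp : p ∣ Nat.card G) (n : ℕ)
    (ρ : G →* Matrix.GeneralLinearGroup (Fin n) K)
    (hCM : InvariantRingIsCohenMacaulay ρ) :
    Subgroup.closure {σ : G | ¬ p ∣ orderOf σ ∨ IsBireflection ρ σ} = ⊤ := by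
  classical
  cases nonempty_fintype G
  by_contra hH
  set H := Subgroup.closure {σ : G | ¬ p ∣ orderOf σ ∨ IsBireflection ρ σ}
  have hnormal : H.Normal := by
    refine ⟨fun σ hσ g ↦ ?_⟩
    have h : H ≤ H.comap (MulAut.conj g).toMonoidHom := by
      refine (Subgroup.closure_le _).2 fun τ hτ ↦ Subgroup.subset_closure ?_
      exact hτ.imp (fun h ↦ by rwa [← MulEquiv.orderOf_eq (MulAut.conj g)] at h)
        fun h ↦ h.conj g
    exact h hσ
  obtain ⟨χ, hχ, hker⟩ := exists_surjective_hom_zmod_of_normal H hH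
    fun σ hσ ↦ Subgroup.subset_closure (Or.inl hσ)
  have hbir (σ : G) (hσ : σ ∉ χ.ker) : ¬ IsBireflection ρ σ⁻¹ := fun h ↦
    hσ ((inv_mem_iff (x := σ)).1 (hker (Subgroup.subset_closure (Or.inr h))))
  obtain ⟨f, hf, hfree⟩ := hCM
  let := polyMulSemiringAction ρ
  have := isInvariant_invariantRing ρ
  have := smulCommClass_invariantRing ρ
  obtain ⟨τ, hτ⟩ := hχ (Multiplicative.ofAdd 1)
  obtain ⟨m, rfl⟩ : ∃ m, n = m + 2 := by
    have hτ' : τ ∉ χ.ker := by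
      rw [MonoidHom.mem_ker, hτ]
      exact fun h ↦ one_ne_zero (α := ZMod p) (congrArg Multiplicative.toAdd h)
    have h := hbir τ hτ'
    rw [IsBireflection] at h
    have h' := Submodule.finrank_quotient_le (fixedSpace ρ τ⁻¹)
    rw [Module.finrank_fin_fun] at h'
    exact ⟨n - 2, by omega⟩
  let c : ZMod p →+* MvPolynomial (Fin (m + 2)) K := C.comp (ZMod.castHom dvd_rfl K)
  obtain ⟨b, hb⟩ := one_mem_cocycleAnnihilator_of_free 
    (A₀ := Algebra.adjoin K (Set.range f)) (A := invariantRing ρ) hχ c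
    hf.algebraicIndependent.aevalEquiv.symm
    fun σ hσ y ↦ exists_aeval_mem_span_polyAction_sub ρ (hbir σ hσ) le_rfl y
  -- `1 = χ τ` would be the constant term of `τ • b - b`, which vanishes.
  have h := congrArg constantCoeff (hb τ)
  rw [hτ] at h
  have h' : constantCoeff (τ • b) = constantCoeff b := constantCoeff_polyAction ρ τ b
  simp [h'] at h
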